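/- Let $W$ be a binary-input memoryless symmetric (BMS) channel with arbitrary output alphabet $\mathcal Y$: its transition probabilities (or densities with respect to a $\sigma$-finite reference measure) $W(y\mid x)$, $x\in\{0,1\}$, satisfy $W(y\mid 0)=W(\pi(y)\mid 1)$ for a (bimeasurable, reference-measure-preserving) permutation $\pi$ of $\mathcal Y$. Let $Z(W)=\int\sqrt{W(y\mid0)W(y\mid1)}\,dy$ be its Bhattacharyya parameter and $C(W)$ its capacity in bits. The minus and plus operations are $$W^0(y_1,y_2\mid x_1)=\sum_{x_2}\tfrac12W(y_1\mid x_1\oplus x_2)W(y_2\mid x_2),\qquad W^1(y_1,y_2,x_1\mid x_2)=\tfrac12W(y_1\mid x_1\oplus x_2)W(y_2\mid x_2).$$ For $n=2^m$ and $i=\sum_{k=1}^m b_k2^{m-k}\in\{0,\dots,n-1\}$ the synthetic channel is $W_n^{(i)}=(((W^{b_1})^{b_2})^{\cdots})^{b_m}$. An information set of the polar code of length $n$ constructed for $W$ is a set $A$ of indices such that $Z(W_n^{(i)})\le Z(W_n^{(j)})$ for all $i\in A$, $j\notin A$; the polar code is the binary linear code spanned by the rows with index in $A$ of $G_n=\begin{bmatrix}1&0\\1&1\end{bmatrix}^{\otimes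 m}$ over $\mathbb F_2$. Put $\kappa=nC(W)$ and $m_0=\log_2(4\kappa^2)$. (1) If $Z(W_n^{(i)})<\frac12$, then $\kappa>0$ and the construction of $W_n^{(i)}$ begins with at least $m-m_0$ plus operations: the number of leading ones of $(b_1,\dots,b_m)$ is at least $m-m_0$. (2) Let $A$ be a non-empty information set of the polar code of length $n$ constructed for $W$, with $Z(W_n^{(i)})<\frac12$ for all $i\in A$, and let $s=\max(0,\lceil m-m_0\rceil)$. Then $s\le m$, $2^{m-s}\le2^{m_0}$, $2^s\ge2^{m-m_0}$, and the polar code equals a polar code of length $2^{m-s}$ and the same dimension followed by $2^s$-fold repetition: there is a set $A'$ of $|A|$ indices in $\{0,\dots,2^{m-s}-1\}$ such that the polar code of length $n$ with information set $A$ is exactly the set of words $(c,c,\dots,c)$ ($2^s$ copies), $c$ ranging over the polar code of length $2^{m-s}$ with information set $A'$. Here $A'$ is an information set of the polar code of length $2^{m-s}$ constructed for the channel obtained from $W$ by $s$ plus operations; if $\pi$ is an involution, it is also an information set of the polar code constructed for the $2^s$-repetition channel, which sends its input bit through $2^s$ independent copies of $W$. -/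

import Mathlib

open MeasureTheory
open scoped Kronecker

noncomputable section

namespace PolarCoding

/-- A (memoryless) channel with input alphabet `𝔽₂ = Fin 2` (addition is `⊕`) and an arbitrary
measurable output alphabet, given by its transition function `W(y ∣ x)`: for each input `x`, a
probability density with respect to a σ-finite reference measure.  For a countable alphabet with
counting measure this is a transition matrix; for the BAWGN channel the reference measure is the
Lebesgue measure. -/
structure BinaryChannel where
  /-- the output alphabet -/
  Out : Type*
  [measurableSpace : MeasurableSpace Out]
  /-- the reference measure -/
  ref : Measure Out
  [sigmaFinite : SigmaFinite ref]
  /-- `trans x y` is `W(y ∣ x)` -/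
  trans : Fin 2 → Out → ℝ
  measurable_trans : ∀ x, Measurable (trans x)
  trans_nonneg : ∀ x y, 0 ≤ trans x y
  integral_trans : ∀ x, ∫ y, trans x y ∂ref = 1

namespace BinaryChannel

attribute [instance] BinaryChannel.measurableSpace BinaryChannel.sigmaFinite

theorem integrable_trans (W : BinaryChannel) (x : Fin 2) : Integrable (W.trans x) W.ref := by
  by_contra h
  have h1 := W.integral_trans x
  rw [integral_undef h] at h1
  exact zero_ne_one h1

/-- `π` is a symmetry of `W`: a permutation of the output alphabet (preserving the reference
measure) such that `W(y ∣ 0) = W(π(y) ∣ 1)`. -/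
def IsSymmetry (W : BinaryChannel) (π : W.Out ≃ᵐ W.Out) : Prop :=
  MeasurePreserving π W.ref W.ref ∧ ∀ᵐ y ∂W.ref, W.trans 0 y = W.trans 1 (π y)

/-- The Bhattacharyya parameter `Z(W) = ∫ √(W(y ∣ 0) W(y ∣ 1)) dy`. -/
def bhattacharyya (W : BinaryChannel) : ℝ :=
  ∫ y, √(W.trans 0 y * W.trans 1 y) ∂W.ref

/-- The mutual information, in bits, between input and output of `W` for the input
distribution `p`. -/
def mutualInfo (W : BinaryChannel) (p : Fin 2 → ℝ) : ℝ :=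
  ∫ y, ∑ x, p x * W.trans x y *
    Real.logb 2 (W.trans x y / ∑ x', p x' * W.trans x' y) ∂W.ref

/-- The Shannon capacity `C(W)`, in bits: the supremum of the mutual information over all input
distributions. -/
def capacity (W : BinaryChannel) : ℝ :=
  ⨆ p : stdSimplex ℝ (Fin 2), W.mutualInfo p

/-- The check (minus) operation
`W⁰(y₁, y₂ ∣ x₁) = ∑_{x₂} ½ W(y₁ ∣ x₁ ⊕ x₂) W(y₂ ∣ x₂)`. -/
def minus (W : BinaryChannel) : BinaryChannel where
  Out := W.Out × W.Out
  ref := W.ref.prod W.ref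
  trans x₁ y := ∑ x₂, 1 / 2 * (W.trans (x₁ + x₂) y.1 * W.trans x₂ y.2)
  measurable_trans x₁ := by
    have := W.measurable_trans
    fun_prop
  trans_nonneg x₁ y := Finset.sum_nonneg fun x₂ _ => mul_nonneg (by norm_num)
    (mul_nonneg (W.trans_nonneg _ _) (W.trans_nonneg _ _))
  integral_trans x₁ := by
    rw [integral_finsetSum]
    · simp only [integral_const_mul, integral_prod_mul, W.integral_trans]
      norm_num
    · exact fun x₂ _ =>
        ((W.integrable_trans (x₁ + x₂)).mul_prod (W.integrable_trans x₂)).const_mul _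

/-- The variable (plus) operation
`W¹(y₁, y₂, x₁ ∣ x₂) = ½ W(y₁ ∣ x₁ ⊕ x₂) W(y₂ ∣ x₂)`. -/
def plus (W : BinaryChannel) : BinaryChannel where
  Out := (W.Out × W.Out) × Fin 2
  ref := (W.ref.prod W.ref).prod Measure.count
  trans x₂ y := 1 / 2 * (W.trans (y.2 + x₂) y.1.1 * W.trans x₂ y.1.2)
  measurable_trans x₂ := by
    have := W.measurable_trans
    refine measurable_from_prod_countable_left fun x₁ => ?_
    dsimp only
    fun_prop
  trans_nonneg x₂ y := mul_nonneg (by norm_num)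
    (mul_nonneg (W.trans_nonneg _ _) (W.trans_nonneg _ _))
  integral_trans x₂ := by
    have key : ∀ x₁ : Fin 2, ∫ y : W.Out × W.Out,
        1 / 2 * (W.trans (x₁ + x₂) y.1 * W.trans x₂ y.2) ∂(W.ref.prod W.ref) = 1 / 2 := by
      intro x₁
      simp only [integral_const_mul, integral_prod_mul, W.integral_trans]
      norm_num
    have hint : ∀ x₁ : Fin 2, Integrable (fun y : W.Out × W.Out =>
        1 / 2 * (W.trans (x₁ + x₂) y.1 * W.trans x₂ y.2)) (W.ref.prod W.ref) := fun x₁ =>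
      ((W.integrable_trans (x₁ + x₂)).mul_prod (W.integrable_trans x₂)).const_mul _
    have hmeas : Measurable (fun y : (W.Out × W.Out) × Fin 2 =>
        1 / 2 * (W.trans (y.2 + x₂) y.1.1 * W.trans x₂ y.1.2)) := by
      have := W.measurable_trans
      refine measurable_from_prod_countable_left fun x₁ => ?_
      dsimp only
      fun_prop
    rw [integral_prod_symm]
    · simp only [key]
      rw [integral_count]
      norm_num
    · rw [integrable_prod_iff' hmeas.aestronglyMeasurable]
      exact ⟨Filter.Eventually.of_forall hint, Integrable.of_finite⟩

/-- The `r`-repetition channel `W^r`: the input bit is sent through `r` independent copies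
of `W`. -/
def repetition (W : BinaryChannel) (r : ℕ) : BinaryChannel where
  Out := Fin r → W.Out
  ref := Measure.pi fun _ => W.ref
  trans x y := ∏ j, W.trans x (y j)
  measurable_trans x := by
    have := W.measurable_trans
    fun_prop
  trans_nonneg x y := Finset.prod_nonneg fun j _ => W.trans_nonneg _ _
  integral_trans x := by
    rw [integral_fintype_prod_eq_prod (𝕜 := ℝ) (fun _ => W.trans x)]
    simp [W.integral_trans]

/-- Apply a list of operations, from left to right: plus for the bit `1` (`true`), minus for the
bit `0` (`false`). -/
def polarize (W : BinaryChannel) (bs : List Bool) : BinaryChannel :=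
  bs.foldl (fun V b => if b then V.plus else V.minus) W

end BinaryChannel

/-- The binary expansion `(b₁, …, b_m)` of `i ∈ {0, …, 2^m - 1}`, most significant bit first. -/
def bits (m : ℕ) (i : Fin (2 ^ m)) : List Bool :=
  List.ofFn fun k : Fin m => (i : ℕ).testBit (m - 1 - k)

/-- The synthetic channel `(((W^{b₁})^{b₂})^⋯)^{b_m}` with index `i`, for block length `2^m`. -/
def BinaryChannel.synthetic (W : BinaryChannel) (m : ℕ) (i : Fin (2 ^ m)) : BinaryChannel :=
  W.polarize (bits m i)

/-- The number of plus operations with which the construction of the `i`-th synthetic channel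
begins, i.e. the number of leading ones among `b₁, …, b_m`. -/
def leadingPlus (m : ℕ) (i : Fin (2 ^ m)) : ℕ :=
  ((bits m i).takeWhile id).length

/-- `G_n = [1 0; 1 1]^{⊗ m}` over `𝔽₂`, for `n = 2^m`. -/
def polarMatrix : (m : ℕ) → Matrix (Fin (2 ^ m)) (Fin (2 ^ m)) (ZMod 2)
  | 0 => 1
  | m + 1 =>
    let e : Fin 2 × Fin (2 ^ m) ≃ Fin (2 ^ (m + 1)) :=
      finProdFinEquiv.trans (finCongr (pow_succ' 2 m).symm)
    Matrix.reindex e e ((!![1, 0; 1, 1] : Matrix (Fin 2) (Fin 2) (ZMod 2)) ⊗ₖ polarMatrix m)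

/-- The linear code of length `2^m` generated by the rows of `G_n` with index in the information
set `A`. -/
def polarCode (m : ℕ) (A : Finset (Fin (2 ^ m))) : Submodule (ZMod 2) (Fin (2 ^ m) → ZMod 2) :=
  Submodule.span (ZMod 2) ((fun i => (polarMatrix m).row i) '' (A : Set (Fin (2 ^ m))))

/-- `A` is an information set of the polar code of length `2^m` constructed for `W`: it consists of
the `#A` best synthetic channels with respect to the Bhattacharyya parameter (ties being broken
arbitrarily). -/
def IsInfoSet (W : BinaryChannel) (m : ℕ) (A : Finset (Fin (2 ^ m))) : Prop :=
  ∀ i ∈ A, ∀ j ∉ A, (W.synthetic m i).bhattacharyya ≤ (W.synthetic m j).bhattacharyya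

/-- Repetition encoding: `c ∈ 𝔽₂^N` is mapped to `(c, c, …, c) ∈ 𝔽₂^n`.  Used for `N ∣ n`, where
each code bit is sent exactly `n / N` times. -/
def repeatWord (N n : ℕ) [NeZero N] : (Fin N → ZMod 2) →ₗ[ZMod 2] (Fin n → ZMod 2) :=
  LinearMap.funLeft (ZMod 2) (ZMod 2) fun j : Fin n => Fin.ofNat N j

end PolarCoding

end

namespace PolarCoding

/-! A low-capacity channel is nearly useless, and a minus operation makes it quadratically worse.
From `1 - Z ≤ C` and Bernoulli's inequality, `Z(W)^r ≥ 1 - r C(W)`; `r` plus-combined copies have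
Bhattacharyya parameter exactly `Z(W)^r`. Let `L` be the number of leading plus operations and `U`
the channel they produce. If a minus follows, then `1 - Z(U⁰) ≤ (1 - Z(U)²)² ≤ (2^(L+1) C)²`. Each
of the remaining `m - L - 1` operations at worst squares `Z`, so by Bernoulli again the final
parameter is at least `1 - 2^(m-L-1) (2^(L+1) C)²`. If it is below 1/2, then `2^m ≤ 2^L · 4κ²`,
which is part (1). The key lemmas are `one_sub_bhattacharyya_le_capacity`,
`one_sub_sq_sq_le_bhattacharyya_minus` and `two_pow_le_of_bhattacharyya_lt`.

For part (2), the rows of `G_n` whose index starts with `s` ones are the rows of the smaller matrix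
repeated `2^s` times, because the lower row of the kernel is `(1, 1)`. Prefixing `s` ones to an
index matches the synthetic channels too, so the information set carries over. The repetition
channel is compared with `s` plus operations through functionals that see only the law of the
likelihood ratio. -/

/-! ### The entropy inequality `h(p) ≤ 2 √(p (1 - p))`. -/

/-- Jensen for `log` at the points `1 + u` and `u` with weights `1 - u` and `u`, whose weighted mean
is exactly 1. -/
theorem one_sub_mul_log_one_add_add_mul_log_nonpos {u : ℝ} (h0 : 0 < u) (h1 : u ≤ 1) :
    (1 - u) * Real.log (1 + u) + u * Real.log u ≤ 0 := by
  have h := strictConcaveOn_log_Ioi.concaveOn.2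
    (Set.mem_Ioi.2 (show 0 < 1 + u by linarith)) (Set.mem_Ioi.2 h0)
    (show 0 ≤ 1 - u by linarith) h0.le (by ring)
  simp only [smul_eq_mul] at h
  rwa [show (1 - u) * (1 + u) + u * u = 1 by ring, Real.log_one] at h

/-- The difference `χ` of the `v`-dependent terms is antitone on `(0, 1]`, since the previous lemma
with `u = v²` gives the sign of its derivative; equality holds at `v = 1`. -/
theorem add_inv_mul_log_one_add_sq_le {v : ℝ} (h0 : 0 < v) (h1 : v ≤ 1) :
    (v + v⁻¹) * Real.log (1 + v ^ 2) ≤ 2 * Real.log 2 + 2 * (v * Real.log v) := by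
  let χ : ℝ → ℝ := fun v => 2 * (v * Real.log v) - (v + v⁻¹) * Real.log (1 + v ^ 2)
  have hd : ∀ x : ℝ, 0 < x → HasDerivAt χ
      ((x ^ 2)⁻¹ * ((1 - x ^ 2) * Real.log (1 + x ^ 2) + x ^ 2 * Real.log (x ^ 2))) x := by
    intro x hx
    have hx2 : (1 + x ^ 2) ≠ 0 := by positivity
    have e1 := ((hasDerivAt_id' x).mul (Real.hasDerivAt_log hx.ne')).const_mul 2
    have e2 := ((hasDerivAt_id' x).add (hasDerivAt_inv hx.ne')).mul
      (((hasDerivAt_pow 2 x).const_add 1).log hx2)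
    refine (e1.sub e2).congr_deriv ?_
    simp only [Real.log_pow, Pi.add_apply]
    field_simp
    push_cast
    ring
  have hanti : AntitoneOn χ (Set.Ioc 0 1) := by
    refine antitoneOn_of_deriv_nonpos (convex_Ioc 0 1)
      (fun x hx => (hd x hx.1).continuousAt.continuousWithinAt)
      (fun x hx => (hd x (interior_subset hx).1).differentiableAt.differentiableWithinAt) ?_
    intro x hx
    have hx' := interior_subset hx
    rw [(hd x hx'.1).deriv]
    refine mul_nonpos_of_nonneg_of_nonpos (by positivity)
      (one_sub_mul_log_one_add_add_mul_log_nonpos (by have := hx'.1; positivity) ?_)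
    exact pow_le_one₀ hx'.1.le hx'.2
  have h := hanti ⟨h0, h1⟩ (Set.right_mem_Ioc.2 one_pos) h1
  simp only [χ] at h
  norm_num at h
  linarith

/-- The entropy bound `h(p) ≤ 2 √(p (1 - p))`, in homogeneous form. -/
theorem add_sub_two_mul_sqrt_mul_log_two_le {a b : ℝ} (ha : 0 ≤ a) (hb : 0 ≤ b) :
    (a + b - 2 * √(a * b)) * Real.log 2 ≤
      a * Real.log (a / ((a + b) / 2)) + b * Real.log (b / ((a + b) / 2)) := by
  wlog hab : a ≤ b generalizing a b
  · have := this hb ha (le_of_not_ge hab)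
    rw [add_comm b a, mul_comm b a] at this
    linarith
  rcases ha.eq_or_lt with rfl | ha
  · rcases hb.eq_or_lt with rfl | hb
    · simp
    · have : b / ((0 + b) / 2) = 2 := by field_simp; ring
      rw [this]
      simp
  have hb : 0 < b := ha.trans_le hab
  obtain ⟨x, hx, rfl⟩ : ∃ x : ℝ, 0 < x ∧ a = x ^ 2 :=
    ⟨√a, Real.sqrt_pos.2 ha, (Real.sq_sqrt ha.le).symm⟩
  obtain ⟨y, hy, rfl⟩ : ∃ y : ℝ, 0 < y ∧ b = y ^ 2 :=
    ⟨√b, Real.sqrt_pos.2 hb, (Real.sq_sqrt hb.le).symm⟩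
  have hxy : x ≤ y := (sq_le_sq₀ hx.le hy.le).1 hab
  -- By homogeneity only the ratio matters: `v = √(a / b)`.
  have h := add_inv_mul_log_one_add_sq_le (v := x / y) (by positivity) ((div_le_one hy).2 hxy)
  rw [← mul_pow, Real.sqrt_sq (by positivity)]
  have e0 : 1 + (x / y) ^ 2 = (x ^ 2 + y ^ 2) / y ^ 2 := by field_simp; ring
  rw [e0, Real.log_div (by positivity) (by positivity), Real.log_div hx.ne' hy.ne',
    Real.log_pow] at h
  have hl : ∀ z : ℝ, 0 < z → Real.log (z ^ 2 / ((x ^ 2 + y ^ 2) / 2)) =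
      2 * Real.log z - (Real.log (x ^ 2 + y ^ 2) - Real.log 2) := by
    intro z hz
    rw [Real.log_div (by positivity) (by positivity), Real.log_div (by positivity) (by positivity),
      Real.log_pow]
    push_cast
    ring
  rw [hl x hx, hl y hy]
  have h2 := mul_le_mul_of_nonneg_left h (show 0 ≤ x * y by positivity)
  have e1 : x * y * ((x / y + (x / y)⁻¹) * (Real.log (x ^ 2 + y ^ 2) - (2 : ℕ) * Real.log y)) =
      (x ^ 2 + y ^ 2) * (Real.log (x ^ 2 + y ^ 2) - 2 * Real.log y) := by
    push_cast
    field_simp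
  have e2 : x * y * (2 * Real.log 2 + 2 * (x / y * (Real.log x - Real.log y))) =
      2 * (x * y) * Real.log 2 + 2 * x ^ 2 * (Real.log x - Real.log y) := by
    field_simp
  rw [e1, e2] at h2
  linarith

/-! ### Bhattacharyya parameter versus capacity. -/

namespace BinaryChannel

theorem sqrt_mul_le_half_add {a b : ℝ} (ha : 0 ≤ a) (hb : 0 ≤ b) : √(a * b) ≤ (a + b) / 2 := by
  rw [Real.sqrt_le_left (by positivity)]
  nlinarith [sq_nonneg (a - b)]

variable (W : BinaryChannel)

theorem integrable_half_add : Integrable (fun y => (W.trans 0 y + W.trans 1 y) / 2) W.ref :=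
  ((W.integrable_trans 0).add (W.integrable_trans 1)).div_const 2

theorem integral_half_add : ∫ y, (W.trans 0 y + W.trans 1 y) / 2 ∂W.ref = 1 := by
  rw [integral_div, integral_add (W.integrable_trans 0) (W.integrable_trans 1),
    W.integral_trans, W.integral_trans]
  norm_num

theorem integrable_sqrt : Integrable (fun y => √(W.trans 0 y * W.trans 1 y)) W.ref := by
  refine W.integrable_half_add.mono'
    ((W.measurable_trans 0).mul (W.measurable_trans 1)).sqrt.aestronglyMeasurable
    (Filter.Eventually.of_forall fun y => ?_)
  rw [Real.norm_of_nonneg (Real.sqrt_nonneg _)]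
  exact sqrt_mul_le_half_add (W.trans_nonneg _ _) (W.trans_nonneg _ _)

theorem bhattacharyya_nonneg : 0 ≤ W.bhattacharyya :=
  integral_nonneg fun _ => Real.sqrt_nonneg _

theorem bhattacharyya_le_one : W.bhattacharyya ≤ 1 := by
  rw [← W.integral_half_add]
  exact integral_mono W.integrable_sqrt W.integrable_half_add fun y =>
    sqrt_mul_le_half_add (W.trans_nonneg _ _) (W.trans_nonneg _ _)

/-- The crude bound `log t ≤ t` suffices: it only serves to dominate the mutual information
integrand, for integrability and for boundedness of the supremum. -/
theorem mul_logb_div_le {w q p : ℝ} (hw : 0 ≤ w) (hp : 0 ≤ p) (hpq : p * w ≤ q) :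
    p * w * Real.logb 2 (w / q) ≤ w / Real.log 2 := by
  have hl : 0 < Real.log 2 := Real.log_pos one_lt_two
  have hpw : 0 ≤ p * w := mul_nonneg hp hw
  have hq : 0 ≤ q := hpw.trans hpq
  rw [Real.logb, mul_div_assoc']
  gcongr
  calc p * w * Real.log (w / q) ≤ p * w * (w / q) := by
        gcongr
        exact Real.log_le_self (by positivity)
    _ = w * (p * w / q) := by ring
    _ ≤ w * 1 := by
        gcongr
        exact div_le_one_of_le₀ hpq hq
    _ = w := mul_one w

theorem mutualInfo_integrand_le (p : Fin 2 → ℝ) (hp : ∀ x, 0 ≤ p x) (y : W.Out) :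
    ∑ x, p x * W.trans x y * Real.logb 2 (W.trans x y / ∑ x', p x' * W.trans x' y) ≤
      (W.trans 0 y + W.trans 1 y) / 2 * (2 / Real.log 2) := by
  calc _ ≤ ∑ x, W.trans x y / Real.log 2 := by
        refine Finset.sum_le_sum fun x _ => mul_logb_div_le (W.trans_nonneg x y) (hp x) ?_
        exact Finset.single_le_sum (f := fun x' => p x' * W.trans x' y)
          (fun x' _ => mul_nonneg (hp x') (W.trans_nonneg x' y)) (Finset.mem_univ x)
    _ = _ := by
        rw [Fin.sum_univ_two]
        ring

theorem bddAbove_mutualInfo :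
    BddAbove (Set.range fun p : stdSimplex ℝ (Fin 2) => W.mutualInfo p) := by
  refine ⟨2 / Real.log 2, ?_⟩
  rintro _ ⟨p, rfl⟩
  have hl : 0 < Real.log 2 := Real.log_pos one_lt_two
  dsimp only
  rw [mutualInfo]
  by_cases hint : Integrable (fun y => ∑ x, (p : Fin 2 → ℝ) x * W.trans x y *
      Real.logb 2 (W.trans x y / ∑ x', (p : Fin 2 → ℝ) x' * W.trans x' y)) W.ref
  · refine (integral_mono hint (W.integrable_half_add.mul_const _) fun y =>
      W.mutualInfo_integrand_le p p.2.1 y).trans_eq ?_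
    rw [integral_mul_const, W.integral_half_add, one_mul]
  -- A non-integrable integrand has integral 0 by convention.
  · rw [integral_undef hint]
    positivity

/-- `C(W) + Z(W) ≥ 1`. -/
theorem one_sub_bhattacharyya_le_capacity : 1 - W.bhattacharyya ≤ W.capacity := by
  have hl : 0 < Real.log 2 := Real.log_pos one_lt_two
  -- The uniform input distribution already gives mutual information at least `1 - Z`.
  let p : stdSimplex ℝ (Fin 2) := ⟨fun _ => 1 / 2, fun _ => by norm_num, by norm_num⟩
  refine le_trans ?_ (le_ciSup W.bddAbove_mutualInfo p)
  have hlow : ∀ y, (W.trans 0 y + W.trans 1 y) / 2 - √(W.trans 0 y * W.trans 1 y) ≤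
      ∑ x, (p : Fin 2 → ℝ) x * W.trans x y *
        Real.logb 2 (W.trans x y / ∑ x', (p : Fin 2 → ℝ) x' * W.trans x' y) := by
    intro y
    have h := add_sub_two_mul_sqrt_mul_log_two_le (W.trans_nonneg 0 y) (W.trans_nonneg 1 y)
    have hp : ∀ x, (p : Fin 2 → ℝ) x = 1 / 2 := fun _ => rfl
    simp only [hp, Fin.sum_univ_two]
    rw [show 1 / 2 * W.trans 0 y + 1 / 2 * W.trans 1 y = (W.trans 0 y + W.trans 1 y) / 2 by ring]
    rw [Real.logb, Real.logb, ← sub_nonneg]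
    rw [← sub_nonneg] at h
    have := div_nonneg h (mul_pos two_pos hl).le
    refine this.trans_eq ?_
    field_simp
  have hup := W.mutualInfo_integrand_le p p.2.1
  have hint : Integrable (fun y => ∑ x, (p : Fin 2 → ℝ) x * W.trans x y *
      Real.logb 2 (W.trans x y / ∑ x', (p : Fin 2 → ℝ) x' * W.trans x' y)) W.ref := by
    refine (W.integrable_half_add.mul_const (2 / Real.log 2)).mono' ?_
      (Filter.Eventually.of_forall fun y => ?_)
    · have := W.measurable_trans
      simp only [Real.logb]
      exact Measurable.aestronglyMeasurable (by fun_prop)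
    · rw [Real.norm_of_nonneg]
      · exact hup y
      · exact (sub_nonneg.2 (sqrt_mul_le_half_add (W.trans_nonneg _ _)
          (W.trans_nonneg _ _))).trans (hlow y)
  rw [← W.integral_half_add, bhattacharyya, ← integral_sub W.integrable_half_add W.integrable_sqrt,
    mutualInfo]
  exact integral_mono (W.integrable_half_add.sub W.integrable_sqrt) hint hlow

end BinaryChannel

/-! ### Indices with leading ones and repeated codewords. -/

theorem bits_succ (m : ℕ) (i : Fin (2 ^ (m + 1))) (j : Fin (2 ^ m)) (b : Bool)
    (h : (i : ℕ) = 2 ^ m * b.toNat + j) : bits (m + 1) i = b :: bits m j := by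
  simp only [bits, List.ofFn_succ]
  congr 1
  · rw [h, Fin.val_zero, Nat.add_sub_cancel, Nat.sub_zero, Nat.testBit_two_pow_mul_add _ j.2]
    cases b <;> simp
  · congr 1
    ext k
    have hk : m + 1 - 1 - (k.succ : ℕ) = m - 1 - k := by
      rw [Fin.val_succ]
      omega
    rw [hk, h, Nat.testBit_two_pow_mul_add _ j.2, if_pos (by omega)]

theorem exists_eq_two_pow_mul_toNat_add (m : ℕ) (i : Fin (2 ^ (m + 1))) :
    ∃ (b : Bool) (j : Fin (2 ^ m)), (i : ℕ) = 2 ^ m * b.toNat + j := by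
  have hi := i.2
  have h2 := pow_succ' 2 m
  rcases lt_or_ge (i : ℕ) (2 ^ m) with h | h
  · exact ⟨false, ⟨i, h⟩, by simp⟩
  · exact ⟨true, ⟨i - 2 ^ m, by omega⟩, by simp; omega⟩

theorem length_bits (m : ℕ) (i : Fin (2 ^ m)) : (bits m i).length = m := by
  simp [bits]

theorem leadingPlus_le (m : ℕ) (i : Fin (2 ^ m)) : leadingPlus m i ≤ m :=
  (List.takeWhile_prefix _).length_le.trans_eq (length_bits m i)

/-- The hypothesis says `i = 2^m - 2^k + j` without truncated subtraction: `i` lies in the last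
block of `2^k` indices. -/
theorem bits_eq_replicate_append {k m : ℕ} (hkm : k ≤ m) (i : Fin (2 ^ m)) (j : Fin (2 ^ k))
    (h : (i : ℕ) + 2 ^ k = 2 ^ m + j) : bits m i = List.replicate (m - k) true ++ bits k j := by
  induction m, hkm using Nat.le_induction with
  | base =>
    obtain rfl : i = j := Fin.ext (by omega)
    simp
  | succ m hkm ih =>
    have h2 := pow_succ' 2 m
    have h3 : 2 ^ k ≤ 2 ^ m := Nat.pow_le_pow_right two_pos hkm
    have hi := i.2
    rw [bits_succ m i ⟨i - 2 ^ m, by omega⟩ true (by simp; omega), ih _ (by simp; omega),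
      Nat.succ_sub hkm, List.replicate_succ, List.cons_append]

theorem two_pow_le_of_le_leadingPlus {k m : ℕ} (hkm : k ≤ m) (i : Fin (2 ^ m))
    (h : m - k ≤ leadingPlus m i) : 2 ^ m ≤ (i : ℕ) + 2 ^ k := by
  induction m, hkm using Nat.le_induction with
  | base => omega
  | succ m hkm ih =>
    obtain ⟨b, j, hij⟩ := exists_eq_two_pow_mul_toNat_add m i
    rw [leadingPlus, bits_succ m i j b hij, Nat.succ_sub hkm] at h
    cases b
    · simp at h
    · simp only [List.takeWhile_cons, id, if_true, List.length_cons] at h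
      have := ih j (Nat.le_of_succ_le_succ h)
      simp only [Bool.toNat_true] at hij
      have h2 := pow_succ' 2 m
      omega

theorem polarMatrix_succ_apply (m : ℕ) (i i' : Fin (2 ^ (m + 1))) (j j' : Fin (2 ^ m))
    (b b' : Fin 2) (h : (i : ℕ) = j + 2 ^ m * b) (h' : (i' : ℕ) = j' + 2 ^ m * b') :
    polarMatrix (m + 1) i i' =
      (!![1, 0; 1, 1] : Matrix (Fin 2) (Fin 2) (ZMod 2)) b b' * polarMatrix m j j' := by
  let e : Fin 2 × Fin (2 ^ m) ≃ Fin (2 ^ (m + 1)) :=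
    finProdFinEquiv.trans (finCongr (pow_succ' 2 m).symm)
  have hi : i = e (b, j) := Fin.ext (by simp [e, finProdFinEquiv, h])
  have hi' : i' = e (b', j') := Fin.ext (by simp [e, finProdFinEquiv, h'])
  rw [polarMatrix, hi, hi']
  simp only [Matrix.reindex_apply, Matrix.submatrix_apply, e, Equiv.symm_apply_apply,
    Matrix.kroneckerMap_apply]

theorem polarMatrix_row_eq_repeatWord {k m : ℕ} (hkm : k ≤ m) (i : Fin (2 ^ m)) (j : Fin (2 ^ k))
    (h : (i : ℕ) + 2 ^ k = 2 ^ m + j) :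
    (polarMatrix m).row i = repeatWord (2 ^ k) (2 ^ m) ((polarMatrix k).row j) := by
  funext l
  simp only [repeatWord, LinearMap.funLeft_apply, Matrix.row]
  induction m, hkm using Nat.le_induction with
  | base =>
    obtain rfl : i = j := Fin.ext (by omega)
    congr 1
    exact Fin.ext (by simp)
  | succ m hkm ih =>
    have h2 := pow_succ' 2 m
    have h3 : 2 ^ k ≤ 2 ^ m := Nat.pow_le_pow_right two_pos hkm
    have hi := i.2
    obtain ⟨b, l', hl⟩ := exists_eq_two_pow_mul_toNat_add m l
    rw [polarMatrix_succ_apply m i l ⟨i - 2 ^ m, by omega⟩ l' 1 (if b then 1 else 0)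
      (by simp; omega) (by cases b <;> simp [hl, add_comm]),
      ih _ (by simp; omega)]
    have hb : (!![1, 0; 1, 1] : Matrix (Fin 2) (Fin 2) (ZMod 2)) 1 (if b then 1 else 0) = 1 := by
      cases b <;> simp
    rw [hb, one_mul]
    congr 1
    refine Fin.ext ?_
    obtain ⟨d, hd⟩ : 2 ^ k ∣ 2 ^ m := pow_dvd_pow 2 hkm
    have hmod : ∀ a : ℕ, (2 ^ m * b.toNat + a) % 2 ^ k = a % 2 ^ k := fun a => by
      rw [hd, mul_assoc, Nat.mul_add_mod]
    rw [Fin.val_ofNat, Fin.val_ofNat, hl, hmod]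

/-- `top` embeds the small index set as the last `2^k` indices, which contain `A`; `A'` is the
preimage of `A`. The equivalence `j ∈ A' ↔ top j ∈ A` is kept because comparing channels also
requires the indices outside `A'`. -/
theorem polarCode_eq_map_repeatWord {k m : ℕ} (hkm : k ≤ m) (A : Finset (Fin (2 ^ m)))
    (hA : ∀ i ∈ A, m - k ≤ leadingPlus m i) :
    ∃ A' : Finset (Fin (2 ^ k)), A'.card = A.card ∧
      (∃ top : Fin (2 ^ k) → Fin (2 ^ m), (∀ j, j ∈ A' ↔ top j ∈ A) ∧
        ∀ j, bits m (top j) = List.replicate (m - k) true ++ bits k j) ∧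
      polarCode m A = (polarCode k A').map (repeatWord (2 ^ k) (2 ^ m)) := by
  have h3 : 2 ^ k ≤ 2 ^ m := Nat.pow_le_pow_right two_pos hkm
  let top : Fin (2 ^ k) → Fin (2 ^ m) := fun j => ⟨2 ^ m - 2 ^ k + j, by have := j.2; omega⟩
  have htop : ∀ j, (top j : ℕ) + 2 ^ k = 2 ^ m + j := fun j => by simp only [top]; omega
  have hinj : Function.Injective top := fun j j' h => by
    have := htop j
    have := htop j'
    have := congrArg Fin.val h
    exact Fin.ext (by omega)
  have himage : (Finset.univ.filter fun j => top j ∈ A).image top = A := by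
    ext i
    simp only [Finset.mem_image, Finset.mem_filter, Finset.mem_univ, true_and]
    constructor
    · rintro ⟨j, hj, rfl⟩
      exact hj
    · intro hi
      have := two_pow_le_of_le_leadingPlus hkm i (hA i hi)
      have hi2 := i.2
      have : top ⟨i + 2 ^ k - 2 ^ m, by omega⟩ = i := Fin.ext (by simp only [top]; omega)
      exact ⟨_, by rwa [this], this⟩
  refine ⟨Finset.univ.filter fun j => top j ∈ A, ?_, ⟨top, by simp, fun j =>
    bits_eq_replicate_append hkm _ _ (htop j)⟩, ?_⟩
  · conv_rhs => rw [← himage]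
    exact (Finset.card_image_of_injective _ hinj).symm
  · conv_lhs => rw [← himage]
    rw [polarCode, polarCode, Submodule.map_span, Finset.coe_image, Set.image_image,
      Set.image_image]
    congr 1
    exact Set.image_congr fun j _ => polarMatrix_row_eq_repeatWord hkm _ _ (htop j)

/-! ### Equivalence of channels and the repetition channel. -/

namespace BinaryChannel

/-- The measurable functions on `ℝ × ℝ` that are positively homogeneous of degree one. -/
structure IsHomogeneous (f : ℝ × ℝ → ENNReal) : Prop where
  measurable : Measurable f
  map_mul : ∀ r : ℝ, 0 ≤ r → ∀ a b, f (r * a, r * b) = ENNReal.ofReal r * f (a, b)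

/-- The `f`-functional `∫ f(W(y ∣ 0), W(y ∣ 1)) dy` of a channel. -/
noncomputable def functional (W : BinaryChannel) (f : ℝ × ℝ → ENNReal) : ENNReal :=
  ∫⁻ y, f (W.trans 0 y, W.trans 1 y) ∂W.ref

/-- Two channels are equivalent if they have the same homogeneous functionals, i.e. the same
law of the likelihood ratio. -/
def Equivalent (U V : BinaryChannel) : Prop :=
  ∀ f, IsHomogeneous f → U.functional f = V.functional f

/-- A channel is exchangeable if it is equivalent to itself with the inputs swapped. -/
def IsExchangeable (U : BinaryChannel) : Prop :=
  ∀ f, IsHomogeneous f → U.functional f = U.functional fun p => f p.swap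

theorem Equivalent.symm {U V : BinaryChannel} (h : U.Equivalent V) : V.Equivalent U :=
  fun f hf => (h f hf).symm

theorem IsHomogeneous.swap {f : ℝ × ℝ → ENNReal} (hf : IsHomogeneous f) :
    IsHomogeneous fun p => f p.swap :=
  ⟨hf.measurable.comp measurable_swap, fun r hr a b => hf.map_mul r hr b a⟩

/-- Precomposition with a linear map. -/
theorem IsHomogeneous.comp_linear {f : ℝ × ℝ → ENNReal} (hf : IsHomogeneous f)
    (p q r s : ℝ) : IsHomogeneous fun x => f (p * x.1 + q * x.2, r * x.1 + s * x.2) := by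
  refine ⟨hf.measurable.comp (by fun_prop), fun t ht a b => ?_⟩
  rw [← hf.map_mul t ht]
  congr 2 <;> ring

theorem IsHomogeneous.lintegral {α : Type*} [MeasurableSpace α] {μ : Measure α} [SFinite μ]
    {F : α → ℝ × ℝ → ENNReal} (hF : ∀ y, IsHomogeneous (F y))
    (hm : Measurable (Function.uncurry F)) : IsHomogeneous fun x => ∫⁻ y, F y x ∂μ := by
  refine ⟨hm.lintegral_prod_left', fun r hr a b => ?_⟩
  simp only [(hF _).map_mul r hr]
  exact lintegral_const_mul _ (hm.comp (measurable_id.prodMk measurable_const))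

/-- The bilinear map `ℝ² × ℝ² → ℝ²` whose components have the matrices `q` and `r`. -/
def bilin (q r : Matrix (Fin 2) (Fin 2) ℝ) (x y : ℝ × ℝ) : ℝ × ℝ :=
  ((q 0 0 * y.1 + q 0 1 * y.2) * x.1 + (q 1 0 * y.1 + q 1 1 * y.2) * x.2,
    (r 0 0 * y.1 + r 0 1 * y.2) * x.1 + (r 1 0 * y.1 + r 1 1 * y.2) * x.2)

/-- The functional of a pair of independent observations, combined by a bilinear map. -/
noncomputable def pairFunctional (U V : BinaryChannel) (f : ℝ × ℝ → ENNReal)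
    (q r : Matrix (Fin 2) (Fin 2) ℝ) : ENNReal :=
  ∫⁻ y, f (bilin q r (U.trans 0 y.1, U.trans 1 y.1) (V.trans 0 y.2, V.trans 1 y.2))
    ∂(U.ref.prod V.ref)

variable {f : ℝ × ℝ → ENNReal}

theorem IsHomogeneous.measurable_bilin (hf : IsHomogeneous f) (U V : BinaryChannel)
    (q r : Matrix (Fin 2) (Fin 2) ℝ) :
    Measurable fun y : U.Out × V.Out =>
      f (bilin q r (U.trans 0 y.1, U.trans 1 y.1) (V.trans 0 y.2, V.trans 1 y.2)) := by
  have := U.measurable_trans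
  have := V.measurable_trans
  refine hf.measurable.comp ?_
  unfold bilin
  fun_prop

theorem isHomogeneous_bilin_left (hf : IsHomogeneous f) (q r : Matrix (Fin 2) (Fin 2) ℝ)
    (y : ℝ × ℝ) :
    IsHomogeneous fun x => f (bilin q r x y) :=
  hf.comp_linear _ _ _ _

theorem bilin_flip (q r : Matrix (Fin 2) (Fin 2) ℝ) (x y : ℝ × ℝ) :
    bilin q r x y = bilin q.transpose r.transpose y x := by
  unfold bilin
  ext <;> simp only [Matrix.transpose_apply] <;> ring

theorem pairFunctional_flip (U V : BinaryChannel) (hf : IsHomogeneous f)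
    (q r : Matrix (Fin 2) (Fin 2) ℝ) :
    pairFunctional U V f q r = pairFunctional V U f q.transpose r.transpose := by
  rw [pairFunctional, lintegral_prod_symm' _ (hf.measurable_bilin U V q r),
    pairFunctional, lintegral_prod _ (hf.measurable_bilin V U _ _).aemeasurable]
  simp only [bilin_flip q r]

/-- Integrating out the second observation leaves a homogeneous functional of the first, so
equivalence can be applied to one factor at a time. -/
theorem pairFunctional_eq_functional (U V : BinaryChannel) (hf : IsHomogeneous f)
    (q r : Matrix (Fin 2) (Fin 2) ℝ) :
    pairFunctional U V f q r =
      U.functional fun x => ∫⁻ y, f (bilin q r x (V.trans 0 y, V.trans 1 y)) ∂V.ref := by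
  rw [pairFunctional, functional,
    lintegral_prod _ (hf.measurable_bilin U V q r).aemeasurable]

theorem isHomogeneous_lintegral_bilin (V : BinaryChannel) (hf : IsHomogeneous f)
    (q r : Matrix (Fin 2) (Fin 2) ℝ) :
    IsHomogeneous fun x => ∫⁻ y, f (bilin q r x (V.trans 0 y, V.trans 1 y)) ∂V.ref := by
  refine IsHomogeneous.lintegral (fun y => isHomogeneous_bilin_left hf q r _) ?_
  have := V.measurable_trans
  refine hf.measurable.comp ?_
  unfold bilin
  fun_prop

theorem pairFunctional_congr_left {U U' : BinaryChannel} (h : U.Equivalent U') (V : BinaryChannel)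
    (hf : IsHomogeneous f) (q r : Matrix (Fin 2) (Fin 2) ℝ) :
    pairFunctional U V f q r = pairFunctional U' V f q r := by
  rw [pairFunctional_eq_functional _ _ hf, pairFunctional_eq_functional _ _ hf,
    h _ (isHomogeneous_lintegral_bilin V hf q r)]

theorem pairFunctional_congr {U U' V V' : BinaryChannel} (h : U.Equivalent U')
    (h' : V.Equivalent V') (hf : IsHomogeneous f) (q r : Matrix (Fin 2) (Fin 2) ℝ) :
    pairFunctional U V f q r = pairFunctional U' V' f q r := by
  rw [pairFunctional_congr_left h V hf, pairFunctional_flip _ _ hf,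
    pairFunctional_congr_left h' _ hf, pairFunctional_flip _ _ hf, Matrix.transpose_transpose,
    Matrix.transpose_transpose]

/-- Rows of `q` and `r` index the input of the first observation, so swapping its inputs reverses
the rows. -/
theorem pairFunctional_swap_left {U : BinaryChannel} (h : U.IsExchangeable) (V : BinaryChannel)
    (hf : IsHomogeneous f) (q r : Matrix (Fin 2) (Fin 2) ℝ) :
    pairFunctional U V f q r =
      pairFunctional U V f (q.submatrix Fin.rev id) (r.submatrix Fin.rev id) := by
  rw [pairFunctional_eq_functional _ _ hf, pairFunctional_eq_functional _ _ hf,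
    h _ (isHomogeneous_lintegral_bilin V hf q r)]
  congr 1
  funext x
  congr 1
  funext y
  congr 1
  have h0 : Fin.rev (0 : Fin 2) = 1 := rfl
  have h1 : Fin.rev (1 : Fin 2) = 0 := rfl
  ext <;> simp [bilin, h0, h1, add_comm]

theorem minus_functional (U : BinaryChannel) (f : ℝ × ℝ → ENNReal) :
    U.minus.functional f = pairFunctional U U f !![1 / 2, 0; 0, 1 / 2] !![0, 1 / 2; 1 / 2, 0] := by
  refine lintegral_congr fun y => ?_
  congr 1
  simp only [minus, bilin, Fin.sum_univ_two]
  ext <;> simp <;> ring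

theorem plus_functional (U : BinaryChannel) (hf : IsHomogeneous f) :
    U.plus.functional f = pairFunctional U U f !![1 / 2, 0; 0, 0] !![0, 0; 0, 1 / 2] +
      pairFunctional U U f !![0, 0; 1 / 2, 0] !![0, 1 / 2; 0, 0] := by
  have hm : Measurable fun y : U.plus.Out => f (U.plus.trans 0 y, U.plus.trans 1 y) :=
    hf.measurable.comp ((U.plus.measurable_trans 0).prodMk (U.plus.measurable_trans 1))
  have h1 : U.plus.functional f = ∑ x : Fin 2, ∫⁻ y : U.Out × U.Out,
      f (U.plus.trans 0 (y, x), U.plus.trans 1 (y, x)) ∂(U.ref.prod U.ref) := by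
    rw [functional]
    refine (lintegral_prod_symm' _ hm).trans ?_
    rw [lintegral_count, tsum_fintype]
  rw [h1, Fin.sum_univ_two]
  congr 1 <;>
  · refine lintegral_congr fun y => ?_
    congr 1
    simp only [plus, bilin]
    ext <;> simp <;> ring

theorem Equivalent.minus {U V : BinaryChannel} (h : U.Equivalent V) :
    U.minus.Equivalent V.minus := fun f hf => by
  rw [minus_functional, minus_functional, pairFunctional_congr h h hf]

theorem Equivalent.plus {U V : BinaryChannel} (h : U.Equivalent V) :
    U.plus.Equivalent V.plus := fun f hf => by
  rw [plus_functional _ hf, plus_functional _ hf, pairFunctional_congr h h hf,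
    pairFunctional_congr h h hf]

theorem Equivalent.polarize {U V : BinaryChannel} (h : U.Equivalent V) (bs : List Bool) :
    (U.polarize bs).Equivalent (V.polarize bs) := by
  induction bs generalizing U V with
  | nil => exact h
  | cons b bs ih =>
    refine ih ?_
    cases b
    · exact h.minus
    · exact h.plus

theorem bhattacharyya_eq_toReal_functional (W : BinaryChannel) : W.bhattacharyya =
    (W.functional fun x : ℝ × ℝ => ENNReal.ofReal √(x.1 * x.2)).toReal :=
  integral_eq_lintegral_of_nonneg_ae (Filter.Eventually.of_forall fun _ => Real.sqrt_nonneg _)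
    ((W.measurable_trans 0).mul (W.measurable_trans 1)).sqrt.aestronglyMeasurable

theorem Equivalent.bhattacharyya_eq {U V : BinaryChannel} (h : U.Equivalent V) :
    U.bhattacharyya = V.bhattacharyya := by
  have hf : IsHomogeneous fun x : ℝ × ℝ => ENNReal.ofReal √(x.1 * x.2) := by
    refine ⟨by fun_prop, fun r hr a b => ?_⟩
    rw [← ENNReal.ofReal_mul hr, mul_mul_mul_comm, Real.sqrt_mul (mul_nonneg hr hr),
      Real.sqrt_mul_self hr]
  rw [bhattacharyya_eq_toReal_functional, bhattacharyya_eq_toReal_functional, h _ hf]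

/-- Involutivity supplies the second relation `W(π(y) ∣ 0) = W(y ∣ 1)`, so that `π` swaps both
densities at once. -/
theorem IsSymmetry.isExchangeable {W : BinaryChannel} {π : W.Out ≃ᵐ W.Out} (h : W.IsSymmetry π)
    (hπ : Function.Involutive π) : W.IsExchangeable := fun f hf => by
  have h1 : ∀ᵐ y ∂W.ref, W.trans 0 (π y) = W.trans 1 y := by
    filter_upwards [h.1.quasiMeasurePreserving.ae h.2] with y hy
    rw [hy, hπ y]
  have hm : Measurable fun y => f (W.trans 1 y, W.trans 0 y) :=
    hf.measurable.comp ((W.measurable_trans 1).prodMk (W.measurable_trans 0))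
  calc W.functional f = ∫⁻ y, f (W.trans 1 (π y), W.trans 0 (π y)) ∂W.ref := by
        refine lintegral_congr_ae ?_
        filter_upwards [h.2, h1] with y h2 h3
        rw [h2, h3]
    _ = _ := h.1.lintegral_comp hm

/-- Two independent observations of the same input, through `U` and through `V`. -/
noncomputable def productFunctional (U V : BinaryChannel) (f : ℝ × ℝ → ENNReal) : ENNReal :=
  pairFunctional U V f !![1, 0; 0, 0] !![0, 0; 0, 1]

/-- The extra output `x₁` only tells whether the inputs of the first observation are flipped. Under
exchangeability both values contribute the same half of the product functional. -/
theorem plus_functional_of_isExchangeable {U : BinaryChannel} (h : U.IsExchangeable)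
    (hf : IsHomogeneous f) : U.plus.functional f = productFunctional U U f := by
  have hrev : pairFunctional U U f !![0, 0; 1 / 2, 0] !![0, 1 / 2; 0, 0] =
      pairFunctional U U f !![1 / 2, 0; 0, 0] !![0, 0; 0, 1 / 2] := by
    rw [pairFunctional_swap_left h _ hf]
    congr 1 <;>
    · ext i j
      fin_cases i <;> fin_cases j <;> rfl
  have hhalf : pairFunctional U U f !![1 / 2, 0; 0, 0] !![0, 0; 0, 1 / 2] =
      ENNReal.ofReal (1 / 2) * productFunctional U U f := by
    rw [productFunctional, pairFunctional, pairFunctional,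
      ← lintegral_const_mul _ (hf.measurable_bilin U U _ _)]
    refine lintegral_congr fun y => ?_
    rw [bilin, bilin, ← hf.map_mul _ (by norm_num)]
    congr 1
    ext <;> simp <;> ring
  rw [plus_functional _ hf, hrev, hhalf, ← add_mul,
    ← ENNReal.ofReal_add (by norm_num) (by norm_num)]
  norm_num

theorem repetition_add_functional (W : BinaryChannel) (p q : ℕ) (hf : IsHomogeneous f) :
    (W.repetition (p + q)).functional f =
      productFunctional (W.repetition p) (W.repetition q) f := by
  have h1 := measurePreserving_sumPiEquivProdPi_symm (fun _ : Fin p ⊕ Fin q => W.ref)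
  have h2 := measurePreserving_piCongrLeft (fun _ : Fin (p + q) => W.ref) finSumFinEquiv
  have hm : Measurable fun y : (W.repetition (p + q)).Out =>
      f ((W.repetition (p + q)).trans 0 y, (W.repetition (p + q)).trans 1 y) :=
    hf.measurable.comp (((W.repetition _).measurable_trans 0).prodMk
      ((W.repetition _).measurable_trans 1))
  refine ((h2.comp h1).lintegral_comp hm).symm.trans (lintegral_congr fun y => ?_)
  have hy : ∀ x, (W.repetition (p + q)).trans x
      (MeasurableEquiv.piCongrLeft (fun _ => W.Out) finSumFinEquiv
        ((MeasurableEquiv.sumPiEquivProdPi fun _ => W.Out).symm y)) =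
      (W.repetition p).trans x y.1 * (W.repetition q).trans x y.2 := by
    intro x
    simp only [repetition, Fin.prod_univ_add]
    congr 1
    · refine Finset.prod_congr rfl fun j _ => ?_
      rw [← finSumFinEquiv_apply_left, MeasurableEquiv.coe_piCongrLeft,
        Equiv.piCongrLeft_apply_apply]
      rfl
    · refine Finset.prod_congr rfl fun j _ => ?_
      rw [← finSumFinEquiv_apply_right, MeasurableEquiv.coe_piCongrLeft,
        Equiv.piCongrLeft_apply_apply]
      rfl
  rw [Function.comp_apply, hy, hy]
  congr 1
  ext <;> simp [bilin, mul_comm]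

theorem repetition_one_equivalent (W : BinaryChannel) : (W.repetition 1).Equivalent W := by
  intro f hf
  have hm : Measurable fun y => f (W.trans 0 y, W.trans 1 y) :=
    hf.measurable.comp ((W.measurable_trans 0).prodMk (W.measurable_trans 1))
  refine Eq.trans (lintegral_congr fun y => ?_)
    ((measurePreserving_funUnique W.ref (Fin 1)).lintegral_comp hm)
  simp [repetition]

theorem IsExchangeable.plus {U : BinaryChannel} (h : U.IsExchangeable) :
    U.plus.IsExchangeable := by
  intro f hf
  rw [plus_functional_of_isExchangeable h hf, plus_functional_of_isExchangeable h hf.swap,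
    productFunctional, pairFunctional_swap_left h _ hf, pairFunctional_flip _ _ hf,
    pairFunctional_swap_left h _ hf]
  exact lintegral_congr fun y => by congr 1

theorem IsExchangeable.polarize_replicate {W : BinaryChannel} (h : W.IsExchangeable) (s : ℕ) :
    (W.polarize (List.replicate s true)).IsExchangeable := by
  induction s generalizing W with
  | zero => exact h
  | succ s ih => exact ih h.plus

theorem polarize_append (W : BinaryChannel) (bs cs : List Bool) :
    W.polarize (bs ++ cs) = (W.polarize bs).polarize cs :=
  List.foldl_append

theorem IsExchangeable.polarize_replicate_equivalent {W : BinaryChannel} (h : W.IsExchangeable)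
    (s : ℕ) : (W.polarize (List.replicate s true)).Equivalent (W.repetition (2 ^ s)) := by
  induction s with
  | zero => exact (repetition_one_equivalent W).symm
  | succ s ih =>
    intro f hf
    rw [List.replicate_succ', polarize_append, pow_succ, mul_two,
      repetition_add_functional _ _ _ hf]
    refine (plus_functional_of_isExchangeable (h.polarize_replicate s) hf).trans ?_
    exact pairFunctional_congr ih ih hf _ _

/-! ### The Bhattacharyya parameter under plus and minus. -/

theorem bhattacharyya_plus (U : BinaryChannel) : U.plus.bhattacharyya = U.bhattacharyya ^ 2 := by
  have hint := U.plus.integrable_sqrt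
  have key : ∀ x : Fin 2, ∫ y : U.Out × U.Out,
      √(U.plus.trans 0 (y, x) * U.plus.trans 1 (y, x)) ∂(U.ref.prod U.ref) =
        1 / 2 * U.bhattacharyya ^ 2 := by
    intro x
    have h : ∀ y : U.Out × U.Out, √(U.plus.trans 0 (y, x) * U.plus.trans 1 (y, x)) =
        1 / 2 * (√(U.trans 0 y.1 * U.trans 1 y.1) * √(U.trans 0 y.2 * U.trans 1 y.2)) := by
      intro y
      -- Flipping the input permutes the two factors, so both values of `x₁` contribute equally.
      have hx : U.trans (x + 0) y.1 * U.trans (x + 1) y.1 = U.trans 0 y.1 * U.trans 1 y.1 := by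
        fin_cases x
        · rfl
        · exact mul_comm _ _
      have h0 := mul_nonneg (U.trans_nonneg 0 y.1) (U.trans_nonneg 1 y.1)
      calc √(U.plus.trans 0 (y, x) * U.plus.trans 1 (y, x))
          = √((1 / 2) ^ 2 * ((U.trans (x + 0) y.1 * U.trans (x + 1) y.1) *
              (U.trans 0 y.2 * U.trans 1 y.2))) := by
            congr 1
            simp only [plus]
            ring
        _ = _ := by
            rw [hx, Real.sqrt_mul (by norm_num), Real.sqrt_sq (by norm_num), Real.sqrt_mul h0]
    simp only [h]
    rw [integral_const_mul, integral_prod_mul (fun y => √(U.trans 0 y * U.trans 1 y))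
      (fun y => √(U.trans 0 y * U.trans 1 y)), sq]
    rfl
  refine (integral_prod_symm _ hint).trans ?_
  simp only [key]
  rw [integral_count, Fin.sum_univ_two]
  ring

theorem minus_trans_zero (U : BinaryChannel) (y : U.Out × U.Out) : U.minus.trans 0 y =
    (U.trans 0 y.1 * U.trans 0 y.2 + U.trans 1 y.1 * U.trans 1 y.2) / 2 := by
  simp only [minus, Fin.sum_univ_two, zero_add]
  ring

theorem minus_trans_one (U : BinaryChannel) (y : U.Out × U.Out) : U.minus.trans 1 y =
    (U.trans 1 y.1 * U.trans 0 y.2 + U.trans 0 y.1 * U.trans 1 y.2) / 2 := by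
  simp only [minus, Fin.sum_univ_two, add_zero, show (1 : Fin 2) + 1 = 0 from rfl]
  ring

theorem bhattacharyya_le_bhattacharyya_minus (U : BinaryChannel) :
    U.bhattacharyya ≤ U.minus.bhattacharyya := by
  have h : ∫ y : U.Out × U.Out, √(U.trans 0 y.1 * U.trans 1 y.1) *
      ((U.trans 0 y.2 + U.trans 1 y.2) / 2) ∂(U.ref.prod U.ref) = U.bhattacharyya := by
    rw [integral_prod_mul (fun y => √(U.trans 0 y * U.trans 1 y))
      (fun y => (U.trans 0 y + U.trans 1 y) / 2), integral_half_add, mul_one]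
    rfl
  rw [← h]
  refine integral_mono (U.integrable_sqrt.mul_prod U.integrable_half_add) U.minus.integrable_sqrt
    fun y => ?_
  dsimp only
  rw [minus_trans_zero, minus_trans_one]
  have ha := U.trans_nonneg 0 y.1
  have hb := U.trans_nonneg 1 y.1
  have hc := U.trans_nonneg 0 y.2
  have hd := U.trans_nonneg 1 y.2
  generalize U.trans 0 y.1 = a at *
  generalize U.trans 1 y.1 = b at *
  generalize U.trans 0 y.2 = c at *
  generalize U.trans 1 y.2 = d at *
  refine Real.le_sqrt_of_sq_le ?_
  rw [mul_pow, Real.sq_sqrt (by positivity)]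
  -- The difference of the two sides is `c d (a - b)² / 4`.
  nlinarith [mul_nonneg (mul_nonneg hc hd) (sq_nonneg (a - b))]

/-- The mean of the squared difference of the two a posteriori probabilities. -/
noncomputable def meanSqBias (U : BinaryChannel) : ℝ :=
  ∫ y, (U.trans 0 y - U.trans 1 y) ^ 2 / (2 * (U.trans 0 y + U.trans 1 y)) ∂U.ref

theorem sq_div_le_half_add {a b : ℝ} (ha : 0 ≤ a) (hb : 0 ≤ b) :
    (a - b) ^ 2 / (2 * (a + b)) ≤ (a + b) / 2 := by
  refine div_le_of_le_mul₀ (by positivity) (by positivity) ?_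
  nlinarith [mul_nonneg ha hb]

theorem integrable_sq_div (U : BinaryChannel) : Integrable
    (fun y => (U.trans 0 y - U.trans 1 y) ^ 2 / (2 * (U.trans 0 y + U.trans 1 y))) U.ref := by
  have := U.measurable_trans
  refine U.integrable_half_add.mono' (Measurable.aestronglyMeasurable (by fun_prop))
    (Filter.Eventually.of_forall fun y => ?_)
  have ha := U.trans_nonneg 0 y
  have hb := U.trans_nonneg 1 y
  rw [Real.norm_of_nonneg (by positivity)]
  exact sq_div_le_half_add ha hb

theorem meanSqBias_nonneg (U : BinaryChannel) : 0 ≤ U.meanSqBias := by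
  refine integral_nonneg fun y => ?_
  have ha := U.trans_nonneg 0 y
  have hb := U.trans_nonneg 1 y
  dsimp only [Pi.zero_apply]
  positivity

/-- Put `Δ = (a - b) / (a + b)`, under the output law of density `(a + b) / 2`. Then `Z` is the mean
of `t = √(1 - Δ²)`, and Jensen for the square takes the form of the tangent line bound `t² ≥ 2zt -
z²` at `z = Z`. -/
theorem meanSqBias_le (U : BinaryChannel) : U.meanSqBias ≤ 1 - U.bhattacharyya ^ 2 := by
  set z := U.bhattacharyya with hz
  have h : ∫ y, ((1 + z ^ 2) * ((U.trans 0 y + U.trans 1 y) / 2) -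
      2 * z * √(U.trans 0 y * U.trans 1 y)) ∂U.ref = 1 - z ^ 2 := by
    rw [integral_sub (U.integrable_half_add.const_mul _) (U.integrable_sqrt.const_mul _),
      integral_const_mul, integral_const_mul, integral_half_add, ← bhattacharyya, ← hz]
    ring
  rw [← h]
  refine integral_mono U.integrable_sq_div
    ((U.integrable_half_add.const_mul _).sub (U.integrable_sqrt.const_mul _)) fun y => ?_
  dsimp only
  have ha := U.trans_nonneg 0 y
  have hb := U.trans_nonneg 1 y
  generalize U.trans 0 y = a at *
  generalize U.trans 1 y = b at *
  rcases (add_nonneg ha hb).eq_or_lt with h0 | h0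
  · obtain rfl : a = 0 := by linarith
    obtain rfl : b = 0 := by linarith
    simp
  · rw [div_le_iff₀ (by positivity)]
    have hs := Real.sq_sqrt (mul_nonneg ha hb)
    nlinarith [sq_nonneg (2 * √(a * b) - z * (a + b))]

/-- Under a minus operation the biases `Δ` of independent observations multiply. Hence `Z(U⁰)` is
the mean of `√(1 - Δ₁²Δ₂²)`, and `√t ≥ t` on `[0, 1]`. -/
theorem one_sub_meanSqBias_sq_le (U : BinaryChannel) :
    1 - U.meanSqBias ^ 2 ≤ U.minus.bhattacharyya := by
  have h : ∫ y : U.Out × U.Out, ((U.trans 0 y.1 + U.trans 1 y.1) / 2 *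
      ((U.trans 0 y.2 + U.trans 1 y.2) / 2) -
      (U.trans 0 y.1 - U.trans 1 y.1) ^ 2 / (2 * (U.trans 0 y.1 + U.trans 1 y.1)) *
      ((U.trans 0 y.2 - U.trans 1 y.2) ^ 2 / (2 * (U.trans 0 y.2 + U.trans 1 y.2))))
      ∂(U.ref.prod U.ref) = 1 - U.meanSqBias ^ 2 := by
    rw [integral_sub (U.integrable_half_add.mul_prod U.integrable_half_add)
      (U.integrable_sq_div.mul_prod U.integrable_sq_div),
      integral_prod_mul (fun y => (U.trans 0 y + U.trans 1 y) / 2)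
        (fun y => (U.trans 0 y + U.trans 1 y) / 2),
      integral_prod_mul
        (fun y => (U.trans 0 y - U.trans 1 y) ^ 2 / (2 * (U.trans 0 y + U.trans 1 y)))
        (fun y => (U.trans 0 y - U.trans 1 y) ^ 2 / (2 * (U.trans 0 y + U.trans 1 y))),
      integral_half_add, ← meanSqBias]
    ring
  rw [← h]
  refine integral_mono ((U.integrable_half_add.mul_prod U.integrable_half_add).sub
    (U.integrable_sq_div.mul_prod U.integrable_sq_div)) U.minus.integrable_sqrt fun y => ?_
  dsimp only
  rw [minus_trans_zero, minus_trans_one]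
  have ha := U.trans_nonneg 0 y.1
  have hb := U.trans_nonneg 1 y.1
  have hc := U.trans_nonneg 0 y.2
  have hd := U.trans_nonneg 1 y.2
  generalize U.trans 0 y.1 = a at *
  generalize U.trans 1 y.1 = b at *
  generalize U.trans 0 y.2 = c at *
  generalize U.trans 1 y.2 = d at *
  rcases (add_nonneg ha hb).eq_or_lt with h0 | h0
  · rw [← h0]
    simp
  rcases (add_nonneg hc hd).eq_or_lt with h1 | h1
  · rw [← h1]
    simp
  set P := (a * c + b * d) / 2 with hP
  set Q := (b * c + a * d) / 2 with hQ
  have hP0 : 0 ≤ P := by positivity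
  have hQ0 : 0 ≤ Q := by positivity
  have hsum : P + Q = (a + b) * (c + d) / 2 := by rw [hP, hQ]; ring
  have hpos : 0 < P + Q := by rw [hsum]; positivity
  have e : (a + b) / 2 * ((c + d) / 2) - (a - b) ^ 2 / (2 * (a + b)) *
      ((c - d) ^ 2 / (2 * (c + d))) = 2 * (P * Q) / (P + Q) := by
    rw [hsum, hP, hQ]
    field_simp
    ring
  -- What remains is that the harmonic mean of `P` and `Q` is at most their geometric mean.
  rw [e, div_le_iff₀ hpos]
  have hs := Real.mul_self_sqrt (mul_nonneg hP0 hQ0)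
  have h2 := sqrt_mul_le_half_add hP0 hQ0
  nlinarith [Real.sqrt_nonneg (P * Q)]

theorem one_sub_sq_sq_le_bhattacharyya_minus (U : BinaryChannel) :
    1 - (1 - U.bhattacharyya ^ 2) ^ 2 ≤ U.minus.bhattacharyya := by
  have h1 := U.one_sub_meanSqBias_sq_le
  have h2 := pow_le_pow_left₀ U.meanSqBias_nonneg U.meanSqBias_le 2
  linarith

/-- A plus squares `Z` exactly, while a minus does not decrease it and `Z ≥ Z²` on `[0, 1]`. -/
theorem bhattacharyya_pow_le_polarize (U : BinaryChannel) (bs : List Bool) :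
    U.bhattacharyya ^ 2 ^ bs.length ≤ (U.polarize bs).bhattacharyya := by
  induction bs generalizing U with
  | nil => simp [polarize]
  | cons b bs ih =>
    rw [List.length_cons, pow_succ', pow_mul]
    cases b
    · refine le_trans ?_ (ih U.minus)
      refine pow_le_pow_left₀ (sq_nonneg _) (le_trans ?_ U.bhattacharyya_le_bhattacharyya_minus) _
      exact pow_le_of_le_one U.bhattacharyya_nonneg U.bhattacharyya_le_one two_ne_zero
    · rw [← bhattacharyya_plus]
      exact ih U.plus

theorem bhattacharyya_polarize_replicate (U : BinaryChannel) (s : ℕ) :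
    (U.polarize (List.replicate s true)).bhattacharyya = U.bhattacharyya ^ 2 ^ s := by
  induction s generalizing U with
  | zero => simp [polarize]
  | succ s ih =>
    rw [pow_succ', pow_mul, ← bhattacharyya_plus]
    exact ih U.plus

theorem one_sub_mul_capacity_le_bhattacharyya_pow (W : BinaryChannel) (n : ℕ) :
    1 - n * W.capacity ≤ W.bhattacharyya ^ n := by
  have hC := W.one_sub_bhattacharyya_le_capacity
  have h := one_add_mul_le_pow (a := W.bhattacharyya - 1)
    (by linarith [W.bhattacharyya_nonneg]) n
  rw [add_sub_cancel] at h
  nlinarith [mul_le_mul_of_nonneg_left hC n.cast_nonneg (α := ℝ)]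

theorem capacity_nonneg (W : BinaryChannel) : 0 ≤ W.capacity :=
  (sub_nonneg.2 W.bhattacharyya_le_one).trans W.one_sub_bhattacharyya_le_capacity

end BinaryChannel

/-! ### The lower bound on the number of leading plus operations. -/

theorem bits_eq_of_leadingPlus_lt {m : ℕ} {i : Fin (2 ^ m)} (h : leadingPlus m i < m) :
    ∃ bs, bits m i = List.replicate (leadingPlus m i) true ++ false :: bs := by
  have h1 := List.takeWhile_append_dropWhile (p := id) (l := bits m i)
  have h2 : (bits m i).takeWhile id = List.replicate (leadingPlus m i) true :=
    List.eq_replicate_of_mem fun b hb => by simpa using List.mem_takeWhile_imp hb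
  rcases hd : (bits m i).dropWhile id with _ | ⟨b, bs⟩
  · rw [hd, List.append_nil] at h1
    have h3 := congrArg List.length h1
    rw [length_bits] at h3
    exact absurd h3 h.ne
  · have hb : id b = false := by
      have := List.head_dropWhile_not (p := id) (l := bits m i) (by simp [hd])
      simpa [hd] using this
    obtain rfl : b = false := hb
    exact ⟨bs, by rw [← h2, ← hd, h1]⟩

theorem two_pow_le_of_bhattacharyya_lt (W : BinaryChannel) (m : ℕ) (i : Fin (2 ^ m))
    (hZ : (W.synthetic m i).bhattacharyya < 1 / 2) :
    (2 : ℝ) ^ m ≤ 2 ^ leadingPlus m i * (4 * (2 ^ m * W.capacity) ^ 2) := by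
  have hC := W.capacity_nonneg
  rcases (leadingPlus_le m i).eq_or_lt with hL | hL
  · have h1 := W.bhattacharyya_pow_le_polarize (bits m i)
    rw [length_bits] at h1
    have h2 := W.one_sub_mul_capacity_le_bhattacharyya_pow (2 ^ m)
    push_cast at h2
    -- With plus operations only, the claim reduces to `4κ² ≥ 1`.
    have h3 : 1 / 2 < 2 ^ m * W.capacity := by
      have h4 : (W.polarize (bits m i)).bhattacharyya < 1 / 2 := hZ
      linarith
    rw [hL]
    refine le_mul_of_one_le_right (by positivity) ?_
    nlinarith
  · obtain ⟨bs, hbs⟩ := bits_eq_of_leadingPlus_lt hL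
    set L := leadingPlus m i with hLdef
    have hlen : m = L + (bs.length + 1) := by
      rw [← length_bits m i, hbs]
      simp
    set N := bs.length with hN
    let U := W.polarize (List.replicate L true)
    -- The square comes from the minus bound, whence the exponent `L + 1` instead of `L`.
    have hU : U.bhattacharyya ^ 2 = W.bhattacharyya ^ (2 ^ (L + 1)) := by
      rw [W.bhattacharyya_polarize_replicate, ← pow_mul, ← pow_succ]
    have h1 : U.minus.bhattacharyya ^ 2 ^ N < 1 / 2 := by
      refine (U.minus.bhattacharyya_pow_le_polarize bs).trans_lt ?_
      rw [BinaryChannel.synthetic, hbs, BinaryChannel.polarize_append] at hZ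
      exact hZ
    have h2 := U.one_sub_sq_sq_le_bhattacharyya_minus
    have h3 := W.one_sub_mul_capacity_le_bhattacharyya_pow (2 ^ (L + 1))
    rw [← hU] at h3
    push_cast at h3
    have h4 : (1 - U.bhattacharyya ^ 2) ^ 2 ≤ (2 ^ (L + 1) * W.capacity) ^ 2 :=
      pow_le_pow_left₀ (sub_nonneg.2 (pow_le_one₀ U.bhattacharyya_nonneg U.bhattacharyya_le_one))
        (by linarith) 2
    have h5 := one_add_mul_le_pow (a := U.minus.bhattacharyya - 1)
      (by linarith [U.minus.bhattacharyya_nonneg]) (2 ^ N)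
    rw [add_sub_cancel] at h5
    push_cast at h5
    have h6 : (2 : ℝ) ^ N * (1 - U.minus.bhattacharyya) ≤
        2 ^ N * (2 ^ (L + 1) * W.capacity) ^ 2 := by
      gcongr
      linarith
    have h7 : 1 ≤ 2 * ((2 : ℝ) ^ N * (2 ^ (L + 1) * W.capacity) ^ 2) := by linarith
    calc (2 : ℝ) ^ m ≤ 2 ^ m * (2 * ((2 : ℝ) ^ N * (2 ^ (L + 1) * W.capacity) ^ 2)) :=
          le_mul_of_one_le_right (by positivity) h7
      _ = 2 ^ L * (4 * (2 ^ m * W.capacity) ^ 2) := by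
          rw [hlen]
          ring

theorem capacity_pos_and_le_leadingPlus (W : BinaryChannel) (m : ℕ) (i : Fin (2 ^ m))
    (hZ : (W.synthetic m i).bhattacharyya < 1 / 2) :
    0 < 2 ^ m * W.capacity ∧
      (m : ℝ) - Real.logb 2 (4 * (2 ^ m * W.capacity) ^ 2) ≤ leadingPlus m i := by
  have h := two_pow_le_of_bhattacharyya_lt W m i hZ
  -- Positivity keeps the logarithm away from its default value at 0.
  have hpos : 0 < 2 ^ m * W.capacity := by
    refine lt_of_le_of_ne (mul_nonneg (by positivity) W.capacity_nonneg) fun h0 => ?_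
    rw [← h0] at h
    have : (0 : ℝ) < 2 ^ m := by positivity
    norm_num at h
    linarith
  refine ⟨hpos, ?_⟩
  have h1 := Real.logb_le_logb_of_le one_lt_two (by positivity) h
  rw [Real.logb_mul (by positivity) (by positivity), Real.logb_pow, Real.logb_pow,
    Real.logb_self_eq_one one_lt_two] at h1
  linarith

end PolarCoding

theorem mainTheorem8 (W : PolarCoding.BinaryChannel) (π : W.Out ≃ᵐ W.Out) (hπ : W.IsSymmetry π)
    (m : ℕ) (κ m₀ : ℝ) (hκ : κ = 2 ^ m * W.capacity) (hm₀ : m₀ = Real.logb 2 (4 * κ ^ 2)) :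
    (∀ i : Fin (2 ^ m), (W.synthetic m i).bhattacharyya < 1 / 2 →
      0 < κ ∧ (m : ℝ) - m₀ ≤ PolarCoding.leadingPlus m i) ∧
    (∀ A : Finset (Fin (2 ^ m)), A.Nonempty → PolarCoding.IsInfoSet W m A →
      (∀ i ∈ A, (W.synthetic m i).bhattacharyya < 1 / 2) →
      ∀ s : ℕ, s = ⌈(m : ℝ) - m₀⌉₊ →
        s ≤ m ∧ (2 : ℝ) ^ (m - s) ≤ (2 : ℝ) ^ m₀ ∧ (2 : ℝ) ^ ((m : ℝ) - m₀) ≤ (2 : ℝ) ^ s ∧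
        ∃ A' : Finset (Fin (2 ^ (m - s))),
          A'.card = A.card ∧
          PolarCoding.IsInfoSet (W.polarize (List.replicate s true)) (m - s) A' ∧
          (Function.Involutive π →
            PolarCoding.IsInfoSet (W.repetition (2 ^ s)) (m - s) A') ∧
          PolarCoding.polarCode m A =
            (PolarCoding.polarCode (m - s) A').map
              (PolarCoding.repeatWord (2 ^ (m - s)) (2 ^ m))) := by
  have part1 : ∀ i : Fin (2 ^ m), (W.synthetic m i).bhattacharyya < 1 / 2 →
      0 < κ ∧ (m : ℝ) - m₀ ≤ PolarCoding.leadingPlus m i := by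
    subst hm₀ hκ
    exact PolarCoding.capacity_pos_and_le_leadingPlus W m
  refine ⟨part1, fun A hA hinfo hZ s hs => ?_⟩
  have hlead : ∀ i ∈ A, s ≤ PolarCoding.leadingPlus m i := fun i hi =>
    hs ▸ Nat.ceil_le.2 (part1 i (hZ i hi)).2
  obtain ⟨i₀, hi₀⟩ := hA
  -- Non-emptiness of `A` enters here: some index of length `m` has at least `s` leading ones.
  have hsm : s ≤ m := (hlead i₀ hi₀).trans (PolarCoding.leadingPlus_le m i₀)
  have hceil : (m : ℝ) - m₀ ≤ s := hs ▸ Nat.le_ceil _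
  refine ⟨hsm, ?_, ?_, ?_⟩
  · rw [← Real.rpow_natCast, Nat.cast_sub hsm]
    exact Real.rpow_le_rpow_of_exponent_le one_le_two (by linarith)
  · rw [← Real.rpow_natCast]
    exact Real.rpow_le_rpow_of_exponent_le one_le_two hceil
  · obtain ⟨A', hcard, ⟨top, hmem, hbits⟩, hcode⟩ :=
      PolarCoding.polarCode_eq_map_repeatWord (Nat.sub_le m s) A
        (by rwa [Nat.sub_sub_self hsm])
    rw [Nat.sub_sub_self hsm] at hbits
    have hinfo' : PolarCoding.IsInfoSet (W.polarize (List.replicate s true)) (m - s) A' := by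
      intro i hi j hj
      have h := hinfo (top i) ((hmem i).1 hi) (top j) (mt (hmem j).2 hj)
      rwa [PolarCoding.BinaryChannel.synthetic, PolarCoding.BinaryChannel.synthetic, hbits, hbits,
        PolarCoding.BinaryChannel.polarize_append, PolarCoding.BinaryChannel.polarize_append] at h
    refine ⟨A', hcard, hinfo', fun hinv i hi j hj => ?_, hcode⟩
    -- Equivalence survives further polarization, so all Bhattacharyya parameters, and hence their
    -- ordering, agree.
    have heq := (hπ.isExchangeable hinv).polarize_replicate_equivalent s
    have h := hinfo' i hi j hj
    rwa [PolarCoding.BinaryChannel.synthetic, PolarCoding.BinaryChannel.synthetic,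
      (heq.polarize (PolarCoding.bits (m - s) i)).bhattacharyya_eq,
      (heq.polarize (PolarCoding.bits (m - s) j)).bhattacharyya_eq] at h
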